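/- Conventions. $I=[0,1]$, and $X^I$ is the space of continuous paths $I\to X$ with the compact-open topology. An *ANR* is a metrizable space $X$ such that, whenever $X$ is embedded as a closed subspace of a metrizable space $Z$, some open neighbourhood of $X$ in $Z$ retracts onto $X$. A *fibration* is a continuous map with the homotopy lifting property for all spaces. A *local section* of a continuous map $p:E\to B$ over a subset $A\subseteq B$ is a continuous map $s:A\to E$ with $p(s(a))=a$ for all $a\in A$. Every "least $n$" below is over the non-negative integers and means $\infty$ if there is no such $n$. - The *sectional number* $\mathrm{sn}(p)$ of a continuous map $p:E\to B$ is the least $n$ for which there are open sets $\emptyset=U_0\subseteq U_1\subseteq\dots\subseteq U_{n+1}=B$ such that $p$ has a local section over $U_i\setminus U_{i-1}$ for each $i=1,\dots,n+1$. - For a continuous map $f:X\to Y$ let $\pi_f:X^I\to X\times Y$, $\pi_f(\alpha)=(\alpha(0),f(\alpha(1)))$, and $\mathrm{TC}(f)=\mathrm{sn}(\pi_f)$. - $\mathrm{TC}(X)$ (respectively $\mathrm{TC}_g(X)$) is the least $n$ such that $X\times X$ can be covered by $n+1$ open (respectively arbitrary) subsets, over each of which $\pi_X:X^I\to X\times X$,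 $\pi_X(\alpha)=(\alpha(0),\alpha(1))$, has a local section. - $\mathrm{cat}(X)$ (respectively $\mathrm{cat}_g(X)$) is the least $n$ such that $X$ can be covered by $n+1$ open (respectively arbitrary) subsets $A_0,\dots,A_n$ with each inclusion $A_i\hookrightarrow X$ homotopic to a constant map. **Theorem.** Let $f:X\to Y$ be a fibration between compact ANR spaces. Then $\mathrm{TC}(f)$ is the least $n$ such that $X\times Y$ can be covered by $n+1$ arbitrary subsets, over each of which $\pi_f$ has a local section. **Corollary.** If $X$ is a compact ANR, then $\mathrm{TC}(X)=\mathrm{TC}_g(X)$. If, in addition, $X$ is connected, then $\mathrm{cat}(X)=\mathrm{cat}_g(X)$. -/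

import Mathlib

universe u v

namespace GenTC

/-- An absolute neighbourhood retract: a metrizable space `X` such that, whenever `X` is embedded
as a closed subspace of a metrizable space `Z`, some open neighbourhood of (the image of) `X` in
`Z` retracts onto `X`. -/
structure IsANR (X : Type u) [TopologicalSpace X] : Prop where
  metrizable : TopologicalSpace.MetrizableSpace X
  exists_retract : ∀ (Z : Type u) [TopologicalSpace Z] [TopologicalSpace.MetrizableSpace Z]
    (e : X → Z), Topology.IsClosedEmbedding e →
      ∃ U : Set Z, IsOpen U ∧ Set.range e ⊆ U ∧
        ∃ r : C(U, X), ∀ (x : X) (hx : e x ∈ U), r ⟨e x, hx⟩ = x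

/-- A Hurewicz fibration: the homotopy lifting property for all spaces `A`. The universe
`max u v` contains the universal test space `{(x, γ) | f x = γ 0} ⊆ X × C(I, Y)`, so that testing
in it gives the lifting property for spaces in every universe. -/
def IsFibration {X : Type u} {Y : Type v} [TopologicalSpace X] [TopologicalSpace Y]
    (f : C(X, Y)) : Prop :=
  ∀ (A : Type (max u v)) [TopologicalSpace A] (H : C(unitInterval × A, Y)) (g : C(A, X)),
    (∀ a, H (0, a) = f (g a)) →
      ∃ K : C(unitInterval × A, X), (∀ a, K (0, a) = g a) ∧ ∀ p, f (K p) = H p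

/-- The least natural number satisfying `P`, and `⊤` if there is none. -/
noncomputable def leastNat (P : ℕ → Prop) : ℕ∞ :=
  ⨅ (n : ℕ) (_ : P n), (n : ℕ∞)

/-- `p` has a continuous (strict) section over the subset `A` of its codomain. -/
def HasLocalSection {E : Type u} {B : Type v} [TopologicalSpace E] [TopologicalSpace B]
    (p : C(E, B)) (A : Set B) : Prop :=
  ∃ s : C(A, E), ∀ a : A, p (s a) = a

/-- The sectional number `sn(p)`: the least `n` for which there are open sets
`∅ = U 0 ⊆ U 1 ⊆ ⋯ ⊆ U (n + 1) = B` such that `p` has a section over each of the `n + 1`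
differences `U (i + 1) \ U i`. -/
noncomputable def sectionalNumber {E : Type u} {B : Type v} [TopologicalSpace E]
    [TopologicalSpace B] (p : C(E, B)) : ℕ∞ :=
  leastNat fun n => ∃ U : Fin (n + 2) → Set B,
    U 0 = ∅ ∧ U (Fin.last (n + 1)) = Set.univ ∧ (∀ i, IsOpen (U i)) ∧ Monotone U ∧
      ∀ i : Fin (n + 1), HasLocalSection p (U i.succ \ U i.castSucc)

/-- The map `π_f : X^I → X × Y`, `α ↦ (α 0, f (α 1))`; `X^I` has the compact-open topology. -/
def piMap {X : Type u} {Y : Type v} [TopologicalSpace X] [TopologicalSpace Y] (f : C(X, Y)) :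
    C(C(unitInterval, X), X × Y) where
  toFun α := (α 0, f (α 1))
  continuous_toFun := by fun_prop

/-- The bi-evaluation map `π_X : X^I → X × X`, `α ↦ (α 0, α 1)`. -/
def biEval (X : Type u) [TopologicalSpace X] : C(C(unitInterval, X), X × X) where
  toFun α := (α 0, α 1)
  continuous_toFun := by fun_prop

/-- The topological complexity `TC(f) = sn(π_f)` of a map. -/
noncomputable def tcMap {X : Type u} {Y : Type v} [TopologicalSpace X] [TopologicalSpace Y]
    (f : C(X, Y)) : ℕ∞ :=
  sectionalNumber (piMap f)

/-- The (Farber) topological complexity `TC(X)`, by open covers of `X × X`. -/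
noncomputable def tc (X : Type u) [TopologicalSpace X] : ℕ∞ :=
  leastNat fun n => ∃ A : Fin (n + 1) → Set (X × X),
    (⋃ i, A i) = Set.univ ∧ ∀ i, IsOpen (A i) ∧ HasLocalSection (biEval X) (A i)

/-- The generalized topological complexity `TC_g(X)`, by arbitrary covers of `X × X`. -/
noncomputable def tcGen (X : Type u) [TopologicalSpace X] : ℕ∞ :=
  leastNat fun n => ∃ A : Fin (n + 1) → Set (X × X),
    (⋃ i, A i) = Set.univ ∧ ∀ i, HasLocalSection (biEval X) (A i)

/-- The Lusternik-Schnirelmann category `cat(f)` of a map, by open covers. -/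
noncomputable def catMap {X : Type u} {Y : Type v} [TopologicalSpace X] [TopologicalSpace Y]
    (f : C(X, Y)) : ℕ∞ :=
  leastNat fun n => ∃ A : Fin (n + 1) → Set X,
    (⋃ i, A i) = Set.univ ∧ ∀ i, IsOpen (A i) ∧ (f.restrict (A i)).Nullhomotopic

/-- The generalized Lusternik-Schnirelmann category `cat_g(f)` of a map, by arbitrary covers. -/
noncomputable def catGenMap {X : Type u} {Y : Type v} [TopologicalSpace X] [TopologicalSpace Y]
    (f : C(X, Y)) : ℕ∞ :=
  leastNat fun n => ∃ A : Fin (n + 1) → Set X,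
    (⋃ i, A i) = Set.univ ∧ ∀ i, (f.restrict (A i)).Nullhomotopic

/-- `cat(X) = cat(id_X)`. -/
noncomputable def cat (X : Type u) [TopologicalSpace X] : ℕ∞ :=
  catMap (ContinuousMap.id X)

/-- `cat_g(X) = cat_g(id_X)`. -/
noncomputable def catGen (X : Type u) [TopologicalSpace X] : ℕ∞ :=
  catGenMap (ContinuousMap.id X)

end GenTC

namespace GenTC

open Set Topology

/-! Everything reduces to enlarging an arbitrary set carrying a local section to an open one. A
section of `piMap f` over `A` is a homotopy on `A` from the first projection to some `w` with `f ∘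
w` the second projection. Viewed in a normed space containing `X`, this homotopy is approximated on
an open neighbourhood (`exists_approx_on_open_nhds`), then retracted back to `X`. Its end now solves
`f ∘ w = q` only approximately; a short homotopy in the ANR `Y`, lifted through the fibration, makes
this exact (`exists_open_homotopic_lift`). The case `f = id` gives TC, and with `q` constant, cat.
-/

/-- The Kuratowski embedding of a compact metric space into its continuous functions. -/
def kuratowski (X : Type u) [MetricSpace X] [CompactSpace X] (x : X) : C(X, ℝ) where
  toFun y := dist x y
  continuous_toFun := by fun_prop

lemma isometry_kuratowski (X : Type u) [MetricSpace X] [CompactSpace X] :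
    Isometry (kuratowski X) := by
  refine Isometry.of_dist_eq fun x y => le_antisymm ?_ ?_
  · refine (ContinuousMap.dist_le dist_nonneg).2 fun z => ?_
    simpa [kuratowski, Real.dist_eq] using abs_dist_sub_le x y z
  · simpa [kuratowski, Real.dist_eq] using
      ContinuousMap.dist_apply_le_dist (f := kuratowski X x) (g := kuratowski X y) y

/-- A compact ANR is a retract of an open set in a normed space, and the retraction moves points
near the space only a little. -/
lemma IsANR.exists_retraction {X : Type u} [MetricSpace X] [CompactSpace X] (hX : IsANR X) :
    ∃ (U : Set C(X, ℝ)) (r : C(U, X)),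
      (∀ x (hx : kuratowski X x ∈ U), r ⟨kuratowski X x, hx⟩ = x) ∧
      ∀ η > 0, ∃ δ > 0, ∀ x v, dist v (kuratowski X x) < δ →
        ∃ hv : v ∈ U, dist (r ⟨v, hv⟩) x < η := by
  obtain ⟨U, hU, hsub, r, hr⟩ := hX.exists_retract C(X, ℝ) (kuratowski X)
    (isometry_kuratowski X).isClosedEmbedding
  refine ⟨U, r, hr, fun η hη => ?_⟩
  -- `O` is open and contains the compact graph of `kuratowski X`, so it contains a uniform
  -- thickening of that graph.
  let O : Set (X × C(X, ℝ)) := {q | ∃ hv : q.2 ∈ U, dist (r ⟨q.2, hv⟩) q.1 < η}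
  have hO : IsOpen O := by
    have hP : IsOpen {q : X × C(X, ℝ) | q.2 ∈ U} := hU.preimage continuous_snd
    have : O = Subtype.val '' {q : {q : X × C(X, ℝ) | q.2 ∈ U} |
        dist (r ⟨q.1.2, q.2⟩) q.1.1 < η} := by
      ext q
      constructor
      · rintro ⟨hv, h⟩
        exact ⟨⟨q, hv⟩, h, rfl⟩
      · rintro ⟨⟨q, hv⟩, h, rfl⟩
        exact ⟨hv, h⟩
    rw [this]
    refine hP.isOpenMap_subtype_val _ (isOpen_lt ?_ continuous_const)
    fun_prop
  have hK : IsCompact (range fun x : X => (x, kuratowski X x)) :=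
    isCompact_range (continuous_id.prodMk (isometry_kuratowski X).continuous)
  obtain ⟨δ, hδ, hsubO⟩ := hK.exists_thickening_subset_open hO (by
    rintro _ ⟨x, rfl⟩
    have hx : kuratowski X x ∈ U := hsub ⟨x, rfl⟩
    exact ⟨hx, by simpa [hr x hx] using hη⟩)
  refine ⟨δ, hδ, fun x v hv => ?_⟩
  refine @hsubO (x, v) (Metric.mem_thickening_iff.2 ⟨_, ⟨x, rfl⟩, ?_⟩)
  simpa [Prod.dist_eq, hδ] using hv

/-- A continuous map from an arbitrary subset of a metric space to a normed space is approximated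
by a continuous map on an open neighbourhood of the subset. -/
lemma exists_approx_on_open_nhds {Z F : Type*} [MetricSpace Z] [NormedAddCommGroup F]
    [NormedSpace ℝ F] {A : Set Z} (s : C(A, F)) (N : A → Set Z) (hN : ∀ a : A, N a ∈ 𝓝 (a : Z))
    {ε : ℝ} (hε : 0 < ε) :
    ∃ V : Set Z, IsOpen V ∧ A ⊆ V ∧ ∃ g : C(V, F), ∀ z : V,
      ∃ a : A, (z : Z) ∈ N a ∧ dist (g z) (s a) < ε := by
  have key : ∀ a : A, ∃ δ : ℝ, 0 < δ ∧ δ ≤ 1 ∧ Metric.ball (a : Z) δ ⊆ N a ∧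
      ∀ b : A, dist b a < 3 * δ → dist (s b) (s a) < ε := by
    intro a
    obtain ⟨δ₁, h₁, hb₁⟩ := Metric.mem_nhds_iff.1 (hN a)
    obtain ⟨δ₂, h₂, hb₂⟩ := Metric.continuous_iff.1 s.continuous a ε hε
    refine ⟨min 1 (min δ₁ (δ₂ / 3)), by positivity, min_le_left _ _,
      (Metric.ball_subset_ball ((min_le_right _ _).trans (min_le_left _ _))).trans hb₁,
      fun b hb => hb₂ b (hb.trans_le ?_)⟩
    linarith [(min_le_right 1 (min δ₁ (δ₂ / 3))).trans (min_le_right _ _)]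
  choose δ hδ0 hδ1 hδN hδs using key
  let V : Set Z := ⋃ a : A, Metric.ball (a : Z) (δ a)
  let S : V → Set A := fun z => {a | (z : Z) ∈ Metric.ball (a : Z) (δ a)}
  have hS : ∀ z : V, (S z).Nonempty := fun z => mem_iUnion.1 z.2
  obtain ⟨g, hg⟩ := exists_continuous_forall_mem_convex_of_local_const
    (t := fun z : V => convexHull ℝ (s '' S z)) (fun z => convex_convexHull ℝ _) (by
      intro z
      obtain ⟨a, ha⟩ := hS z
      refine ⟨s a, ?_⟩
      have : ∀ᶠ y : V in 𝓝 z, (y : Z) ∈ Metric.ball (a : Z) (δ a) :=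
        continuous_subtype_val.continuousAt.eventually (Metric.isOpen_ball.mem_nhds ha)
      filter_upwards [this] with y hy
      exact subset_convexHull ℝ _ ⟨a, hy, rfl⟩)
  refine ⟨V, isOpen_iUnion fun a => Metric.isOpen_ball,
    fun a ha => mem_iUnion.2 ⟨⟨a, ha⟩, Metric.mem_ball_self (hδ0 _)⟩, g, fun z => ?_⟩
  have hbdd : BddAbove (δ '' S z) := ⟨1, by rintro _ ⟨a, -, rfl⟩; exact hδ1 a⟩
  have hpos : 0 < sSup (δ '' S z) := by
    obtain ⟨a, ha⟩ := hS z
    exact (hδ0 a).trans_le (le_csSup hbdd ⟨a, ha, rfl⟩)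
  -- Choose `a` with radius above half the supremum: every `b` in `S z` has `δ b < 2 * δ a`, so it
  -- lies within `3 * δ a` of `a`.
  obtain ⟨_, ⟨a, ha, rfl⟩, hlt⟩ := exists_lt_of_lt_csSup ((hS z).image δ) (half_lt_self hpos)
  refine ⟨a, hδN a ha, ?_⟩
  have hsub : s '' S z ⊆ Metric.ball (s a) ε := by
    rintro _ ⟨b, hb, rfl⟩
    refine hδs a b ?_
    have h₁ : δ b ≤ sSup (δ '' S z) := le_csSup hbdd ⟨b, hb, rfl⟩
    have h₂ : dist (z : Z) b < δ b := hb
    have h₃ : dist (z : Z) a < δ a := ha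
    have h₄ : dist (b : Z) a ≤ dist (z : Z) b + dist (z : Z) a := dist_triangle_left _ _ _
    rw [Subtype.dist_eq]
    linarith
  exact convexHull_min hsub (convex_ball _ _) (hg z)

/-! ### Extending deformations to open neighbourhoods -/

/-- A deformation over an arbitrary subset, into a compact ANR and relative to a fibration, gives
one over an open neighbourhood. -/
lemma exists_open_homotopic_lift {X : Type u} {Y : Type v} [TopologicalSpace X]
    [TopologicalSpace Y] [CompactSpace X] [CompactSpace Y] {f : C(X, Y)} (hX : IsANR X)
    (hY : IsANR Y) (hf : IsFibration f) {Z : Type (max u v)} [TopologicalSpace Z]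
    [TopologicalSpace.MetrizableSpace Z] (p : C(Z, X)) (q : C(Z, Y)) {A : Set Z}
    (hA : ∃ w : C(A, X), (p.restrict A).Homotopic w ∧ f.comp w = q.restrict A) :
    ∃ V : Set Z, IsOpen V ∧ A ⊆ V ∧
      ∃ w : C(V, X), (p.restrict V).Homotopic w ∧ f.comp w = q.restrict V := by
  have := hX.metrizable
  have := hY.metrizable
  let := TopologicalSpace.metrizableSpaceMetric X
  let := TopologicalSpace.metrizableSpaceMetric Y
  let := TopologicalSpace.metrizableSpaceMetric Z
  obtain ⟨w, ⟨H⟩, hw⟩ := hA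
  obtain ⟨U, r, hr, hrX⟩ := hX.exists_retraction
  obtain ⟨U', r', hr', hrY⟩ := hY.exists_retraction
  have eX := isometry_kuratowski X
  have eY := isometry_kuratowski Y
  obtain ⟨δY, hδY, hUY⟩ := hrY 1 one_pos
  obtain ⟨η, hη, hfη⟩ := Metric.uniformContinuous_iff.1
    (CompactSpace.uniformContinuous_of_continuous f.continuous) (δY / 2) (half_pos hδY)
  obtain ⟨δX, hδX, hUX⟩ := hrX η hη
  -- Approximating in the normed space of paths makes the estimate uniform in time.
  let s : C(A, C(unitInterval, C(X, ℝ))) := ContinuousMap.curry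
    ⟨fun x : A × unitInterval => kuratowski X (H (x.2, x.1)), eX.continuous.comp (by fun_prop)⟩
  obtain ⟨V, hV, hAV, g, hg⟩ := exists_approx_on_open_nhds
    (F := C(unitInterval, C(X, ℝ))) s
    (fun a => {z | dist (p z) (p a) < δX / 3 ∧ dist (q z) (q a) < δY / 2})
    (fun a => (p.continuous.continuousAt.eventually (Metric.ball_mem_nhds _ (by positivity))).and
      (q.continuous.continuousAt.eventually (Metric.ball_mem_nhds _ (by positivity))))
    (ε := δX / 3) (by positivity)
  -- Translating each path makes it start exactly at `p z`. The shift is below `2 * δX / 3`, so the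
  -- total error stays below `δX`.
  let g' : unitInterval × V → C(X, ℝ) := fun x => g x.2 x.1 + (kuratowski X (p x.2) - g x.2 0)
  have hg'c : Continuous g' := by
    have h₁ : Continuous fun x : unitInterval × V => kuratowski X (p x.2) :=
      eX.continuous.comp (by fun_prop)
    have h₂ : Continuous fun x : unitInterval × V => g x.2 x.1 := by fun_prop
    have h₃ : Continuous fun x : unitInterval × V => g x.2 0 := by fun_prop
    exact h₂.add (h₁.sub h₃)
  have hg' : ∀ z : V, ∃ a : A, dist (q z) (q a) < δY / 2 ∧
      ∀ t, dist (g' (t, z)) (kuratowski X (H (t, a))) < δX := by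
    intro z
    obtain ⟨a, ⟨hpa, hqa⟩, hga⟩ := hg z
    refine ⟨a, hqa, fun t => ?_⟩
    have ht : dist (g z t) (kuratowski X (H (t, a))) < δX / 3 :=
      (ContinuousMap.dist_apply_le_dist t).trans_lt hga
    have h0 : dist (g z 0) (kuratowski X (p a)) < δX / 3 := by
      have := (ContinuousMap.dist_apply_le_dist (0 : unitInterval)).trans_lt hga
      simpa [s] using this
    have hp : dist (kuratowski X (p z)) (kuratowski X (p a)) < δX / 3 := by
      rwa [eX.dist_eq]
    have h1 : dist (g' (t, z)) (g z t) = dist (kuratowski X (p z)) (g z 0) := by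
      simp [g', dist_eq_norm]
    have h2 := dist_triangle_right (kuratowski X (p z)) (g z 0) (kuratowski X (p a))
    have h3 := dist_triangle (g' (t, z)) (g z t) (kuratowski X (H (t, a)))
    linarith
  have hmem : ∀ x, g' x ∈ U := fun x => by
    obtain ⟨a, -, ha⟩ := hg' x.2
    exact (hUX _ _ (ha x.1)).1
  let G : C(unitInterval × V, X) := ⟨fun x => r ⟨g' x, hmem x⟩, by fun_prop⟩
  have hG0 : ∀ z, G (0, z) = p z := by
    intro z
    have h : g' (0, z) = kuratowski X (p z) := by simp [g']
    have h' : kuratowski X (p z) ∈ U := h ▸ hmem (0, z)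
    rw [← hr (p z) h']
    simp only [G, ContinuousMap.coe_mk, h]
  have hG1 : ∀ z : V, dist (f (G (1, z))) (q z) < δY := by
    intro z
    obtain ⟨a, hqa, ha⟩ := hg' z
    have h1 : dist (f (G (1, z))) (f (H (1, a))) < δY / 2 := hfη (hUX _ _ (ha 1)).2
    have h2 : f (H (1, a)) = q a := by
      rw [H.apply_one]
      exact DFunLike.congr_fun hw a
    rw [h2] at h1
    have := dist_triangle_right (f (G (1, z))) (q z) (q a)
    linarith
  -- The segment from `f (G (1, z))` to `q z` stays within `δY` of its start, hence in the domain of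
  -- `r'`.
  let l : unitInterval × V → C(Y, ℝ) := fun x => kuratowski Y (f (G (1, x.2))) +
    (x.1 : ℝ) • (kuratowski Y (q x.2) - kuratowski Y (f (G (1, x.2))))
  have hlc : Continuous l := by
    have h₁ : Continuous fun x : unitInterval × V => kuratowski Y (f (G (1, x.2))) :=
      eY.continuous.comp (by fun_prop)
    have h₂ : Continuous fun x : unitInterval × V => kuratowski Y (q x.2) :=
      eY.continuous.comp (by fun_prop)
    exact h₁.add ((by fun_prop : Continuous fun x : unitInterval × V => (x.1 : ℝ)).smul
      (h₂.sub h₁))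
  have hlmem : ∀ x, l x ∈ U' := fun x => by
    refine (hUY (f (G (1, x.2))) _ ?_).1
    have h := hG1 x.2
    rw [← eY.dist_eq, dist_comm, dist_eq_norm] at h
    simp only [l, dist_eq_norm, add_sub_cancel_left, norm_smul]
    refine lt_of_le_of_lt (mul_le_of_le_one_left (norm_nonneg _) ?_) h
    rw [Real.norm_of_nonneg x.1.2.1]
    exact x.1.2.2
  let L : C(unitInterval × V, Y) := ⟨fun x => r' ⟨l x, hlmem x⟩, by fun_prop⟩
  have hL0 : ∀ z, L (0, z) = f (G (1, z)) := by
    intro z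
    have h : l (0, z) = kuratowski Y (f (G (1, z))) := by simp [l]
    have h' : kuratowski Y (f (G (1, z))) ∈ U' := h ▸ hlmem (0, z)
    rw [← hr' _ h']
    simp only [L, ContinuousMap.coe_mk, h]
  have hL1 : ∀ z, L (1, z) = q z := by
    intro z
    have h : l (1, z) = kuratowski Y (q z) := by simp [l]
    have h' : kuratowski Y (q z) ∈ U' := h ▸ hlmem (1, z)
    rw [← hr' _ h']
    simp only [L, ContinuousMap.coe_mk, h]
  let m : C(V, X) := ⟨fun z => G (1, z), by fun_prop⟩
  obtain ⟨K, hK0, hK⟩ := hf V L m hL0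
  let k : C(V, X) := ⟨fun z => K (1, z), by fun_prop⟩
  let hpm : (p.restrict V).Homotopy m := ⟨G, hG0, fun _ => rfl⟩
  let hmk : m.Homotopy k := ⟨K, hK0, fun _ => rfl⟩
  exact ⟨V, hV, hAV, k, ⟨hpm.trans hmk⟩, ContinuousMap.ext fun z => (hK _).trans (hL1 z)⟩

/-! ### Local sections, covers and filtrations -/

lemma isFibration_id (X : Type u) [TopologicalSpace X] : IsFibration (ContinuousMap.id X) :=
  fun _ _ H _ hg => ⟨H, hg, fun _ => rfl⟩

lemma hasLocalSection_piMap_iff {X : Type u} {Y : Type v} [TopologicalSpace X]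
    [TopologicalSpace Y] (f : C(X, Y)) (A : Set (X × Y)) :
    HasLocalSection (piMap f) A ↔ ∃ w : C(A, X),
      ((ContinuousMap.fst : C(X × Y, X)).restrict A).Homotopic w ∧
        f.comp w = (ContinuousMap.snd : C(X × Y, Y)).restrict A := by
  constructor
  · rintro ⟨s, hs⟩
    refine ⟨⟨fun a => s a 1, by fun_prop⟩, ⟨⟨⟨fun x => s x.2 x.1, by fun_prop⟩,
      fun a => congrArg Prod.fst (hs a), fun _ => rfl⟩⟩,
      ContinuousMap.ext fun a => congrArg Prod.snd (hs a)⟩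
  · rintro ⟨w, ⟨H⟩, hw⟩
    refine ⟨ContinuousMap.curry ⟨fun x => H (x.2, x.1), by fun_prop⟩, fun a => ?_⟩
    refine Prod.ext (H.apply_zero a) ?_
    change f (H (1, a)) = _
    rw [H.apply_one]
    exact DFunLike.congr_fun hw a

lemma HasLocalSection.mono {E : Type u} {B : Type v} [TopologicalSpace E] [TopologicalSpace B]
    {p : C(E, B)} {A A' : Set B} (h : HasLocalSection p A) (hA : A' ⊆ A) :
    HasLocalSection p A' := by
  obtain ⟨s, hs⟩ := h
  exact ⟨s.comp ⟨inclusion hA, continuous_inclusion hA⟩, fun a => hs (inclusion hA a)⟩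

/-- A local section over an arbitrary subset can be replaced by one over an open neighbourhood. -/
lemma HasLocalSection.exists_isOpen {X : Type u} {Y : Type v} [TopologicalSpace X]
    [TopologicalSpace Y] [CompactSpace X] [CompactSpace Y] {f : C(X, Y)} (hX : IsANR X)
    (hY : IsANR Y) (hf : IsFibration f) {A : Set (X × Y)} (h : HasLocalSection (piMap f) A) :
    ∃ V, IsOpen V ∧ A ⊆ V ∧ HasLocalSection (piMap f) V := by
  have := hX.metrizable
  have := hY.metrizable
  simp only [hasLocalSection_piMap_iff] at h ⊢
  exact exists_open_homotopic_lift hX hY hf _ _ h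

/-- A set deformable to a point in a compact ANR has an open neighbourhood with that property. -/
lemma exists_isOpen_nullhomotopic {X : Type u} [TopologicalSpace X] [CompactSpace X]
    (hX : IsANR X) {A : Set X} (h : ((ContinuousMap.id X).restrict A).Nullhomotopic) :
    ∃ V, IsOpen V ∧ A ⊆ V ∧ ((ContinuousMap.id X).restrict V).Nullhomotopic := by
  have := hX.metrizable
  obtain ⟨y, hy⟩ := h
  -- With `f = id` and `q` constant, the equation `f ∘ w = q` forces `w` to be constant.
  obtain ⟨V, hV, hAV, w, hw, hwy⟩ := exists_open_homotopic_lift hX hX (isFibration_id X)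
    (ContinuousMap.id X) (ContinuousMap.const X y) ⟨ContinuousMap.const A y, hy, rfl⟩
  refine ⟨V, hV, hAV, y, ?_⟩
  have : w = ContinuousMap.const V y := hwy
  exact this ▸ hw

lemma leastNat_congr {P Q : ℕ → Prop} (h : ∀ n, P n ↔ Q n) : leastNat P = leastNat Q :=
  congrArg leastNat (funext fun n => propext (h n))

/-- If each set with property `P` lies in an open set with property `P`, then covers by open sets
with property `P` exist as soon as covers by arbitrary such sets do. -/
lemma exists_open_cover_iff {ι B : Type*} [TopologicalSpace B] {P : Set B → Prop}
    (hP : ∀ A, P A → ∃ V, IsOpen V ∧ A ⊆ V ∧ P V) :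
    (∃ A : ι → Set B, (⋃ i, A i) = univ ∧ ∀ i, IsOpen (A i) ∧ P (A i)) ↔
      ∃ A : ι → Set B, (⋃ i, A i) = univ ∧ ∀ i, P (A i) := by
  constructor
  · rintro ⟨A, hA, h⟩
    exact ⟨A, hA, fun i => (h i).2⟩
  · rintro ⟨A, hA, h⟩
    choose V hV hAV hPV using fun i => hP (A i) (h i)
    exact ⟨V, univ_subset_iff.1 (hA ▸ iUnion_mono hAV), fun i => ⟨hV i, hPV i⟩⟩

/-- The filtrations defining the sectional number and covers, when local sections extend to open
neighbourhoods. -/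
lemma exists_filtration_iff {E : Type u} {B : Type v} [TopologicalSpace E] [TopologicalSpace B]
    {p : C(E, B)}
    (hp : ∀ A, HasLocalSection p A → ∃ V, IsOpen V ∧ A ⊆ V ∧ HasLocalSection p V) (n : ℕ) :
    (∃ U : Fin (n + 2) → Set B, U 0 = ∅ ∧ U (Fin.last (n + 1)) = univ ∧ (∀ i, IsOpen (U i)) ∧
      Monotone U ∧ ∀ i : Fin (n + 1), HasLocalSection p (U i.succ \ U i.castSucc)) ↔
      ∃ A : Fin (n + 1) → Set B, (⋃ i, A i) = univ ∧ ∀ i, HasLocalSection p (A i) := by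
  constructor
  · rintro ⟨U, h0, hlast, -, -, hU⟩
    refine ⟨fun i => U i.succ \ U i.castSucc, eq_univ_of_forall fun b => ?_, hU⟩
    by_contra hb
    have hb' : ∀ i : Fin (n + 1), b ∈ U i.succ → b ∈ U i.castSucc := fun i hi => by
      by_contra h
      exact hb (mem_iUnion.2 ⟨i, hi, h⟩)
    have : ∀ j : Fin (n + 2), b ∉ U j := by
      intro j
      induction j using Fin.induction with
      | zero => simp [h0]
      | succ i ih => exact fun h => ih (hb' i h)
    exact this (Fin.last (n + 1)) (hlast ▸ mem_univ b)
  · intro h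
    obtain ⟨A, hA, hAo⟩ := (exists_open_cover_iff hp).2 h
    -- Partial unions over `i < j`: the first is empty, and the `i`-th difference lies in `A i`.
    refine ⟨fun j => ⋃ (i : Fin (n + 1)) (_ : i.castSucc < j), A i, by simp, ?_, ?_, ?_, ?_⟩
    · simpa [Fin.castSucc_lt_last] using hA
    · exact fun j => isOpen_iUnion fun i => isOpen_iUnion fun _ => (hAo i).1
    · exact fun j k hjk => iUnion_mono fun i => iUnion_mono' fun h => ⟨h.trans_le hjk, le_rfl⟩
    · refine fun i => (hAo i).2.mono ?_
      rintro b ⟨hb, hb'⟩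
      simp only [mem_iUnion, exists_prop, not_exists, not_and] at hb hb'
      obtain ⟨k, hk, hbk⟩ := hb
      rcases (Fin.le_castSucc_iff.2 hk : k.castSucc ≤ i.castSucc).lt_or_eq with h | h
      · exact absurd hbk (hb' k h)
      · rwa [← Fin.castSucc_injective _ h]

end GenTC

theorem mainTheorem4 :
    (∀ (X : Type u) (Y : Type v) [TopologicalSpace X] [TopologicalSpace Y]
        [CompactSpace X] [CompactSpace Y] (f : C(X, Y)),
        GenTC.IsANR X → GenTC.IsANR Y → GenTC.IsFibration f →
          GenTC.tcMap f = GenTC.leastNat fun n =>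
            ∃ A : Fin (n + 1) → Set (X × Y),
              (⋃ i, A i) = Set.univ ∧ ∀ i, GenTC.HasLocalSection (GenTC.piMap f) (A i)) ∧
    (∀ (X : Type u) [TopologicalSpace X] [CompactSpace X], GenTC.IsANR X →
        GenTC.tc X = GenTC.tcGen X ∧
          (ConnectedSpace X → GenTC.cat X = GenTC.catGen X)) := by
  refine ⟨fun X Y _ _ _ _ f hX hY hf => ?_, fun X _ _ hX => ⟨?_, fun _ => ?_⟩⟩
  · exact GenTC.leastNat_congr (GenTC.exists_filtration_iff
      fun _ h => h.exists_isOpen hX hY hf)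
  · exact GenTC.leastNat_congr fun n => GenTC.exists_open_cover_iff
      -- `biEval X` is definitionally `piMap` of the identity.
      fun _ h => GenTC.HasLocalSection.exists_isOpen hX hX (GenTC.isFibration_id X) h
  · exact GenTC.leastNat_congr fun n => GenTC.exists_open_cover_iff
      fun _ h => GenTC.exists_isOpen_nullhomotopic hX h
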